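/- Let $W$ be a one-dimensional real Brownian motion on a probability space $(\Omega,\mathscr F,\mathbb P)$, let $s>\frac12$, let $\sigma\le 2$ be a nonnegative integer, let $T>0$, $N\in\mathbb N^+$, $\delta t=T/N$, $t_n=n\,\delta t$ and $\delta W_n=W(t_{n+1})-W(t_n)$. Consider in $H^s(\mathbb R;\mathbb C)$ the mid-point scheme $$ \mathrm i\,\frac{u^{n+1}-u^n}{\delta t}+\frac{\delta W_n}{\delta t}\,\Delta u^{n+\frac12}+|u^{n+\frac12}|^{2\sigma}u^{n+\frac12}=0,\qquad u^{n+\frac12}=\tfrac12(u^n+u^{n+1}),\qquad 0\le n\le N-1, $$ where the equation is understood in the sense of tempered distributions on $\mathbb R$. 1. (Symplectic structure.) For almost every $\omega$, let $D(\omega)\subseteq H^s$ be an open set of initial data and let $v\mapsto u^n(\omega,v)\in H^s$, $v\in D(\omega)$, $0\le n\le N$, be a phase flow of the scheme, i.e. $u^0(\omega,v)=v$ and $(u^n(\omega,v))_{0\le n\le N}$ solves the scheme along $\omega$ for every $v\in D(\omega)$. Write $p^n=\operatorname{Re}u^n$, $q^n=\operatorname{Im}u^n$, let $dp^n$, $dq^n$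 be their differentials with respect to the initial datum $v$, and let $$ \bar\omega^n=\int_{\mathbb R}dp^n\wedge dq^n\,dx,\qquad \bar\omega^n_v(h,k)=\int_{\mathbb R}\bigl(dp^n_v(h)\,dq^n_v(k)-dp^n_v(k)\,dq^n_v(h)\bigr)\,dx,\quad h,k\in H^s . $$ Then, almost surely, for all $0\le n\le N-1$ one has $\bar\omega^{n+1}_v=\bar\omega^n_v$ at every $v\in D(\omega)$ at which the two maps $u^n(\omega,\cdot)$ and $u^{n+1}(\omega,\cdot)$ are (real) Fréchet differentiable from $H^s$ to $H^s$. 2. (Charge.) If random elements $u^0,\dots,u^N$ of $H^s$ solve the scheme almost surely, then, almost surely, $Q(u^{n+1})=Q(u^n)$ for all $0\le n\le N-1$, where $Q(u)=\int_{\mathbb R}|u|^2\,dx$. -/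

import Mathlib

open MeasureTheory ProbabilityTheory TemperedDistribution
open scoped NNReal ENNReal SchwartzMap Laplacian

noncomputable section

namespace MidpointNLS

/-- The linear subspace of `L²(ℝ; ℂ)` of the functions of Sobolev regularity `s`, that is, of
those `f` for which `(1 + |ξ|²)^{s/2} 𝓕 f` is square integrable. -/
def sobolevSubmodule (s : ℝ) : Submodule ℂ (Lp ℂ 2 (volume : Measure ℝ)) where
  carrier := {f | MemSobolev s 2 (f : 𝓢'(ℝ, ℂ))}
  zero_mem' := by
    have h : ((0 : Lp ℂ 2 (volume : Measure ℝ)) : 𝓢'(ℝ, ℂ)) = 0 :=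
      map_zero (Lp.toTemperedDistributionCLM ℂ volume 2)
    simp only [Set.mem_ofPred_eq, h, memSobolev_fun_zero]
  add_mem' := by
    intro f g hf hg
    have h : ((f + g : Lp ℂ 2 (volume : Measure ℝ)) : 𝓢'(ℝ, ℂ)) = (f : 𝓢'(ℝ, ℂ)) + g :=
      map_add (Lp.toTemperedDistributionCLM ℂ volume 2) f g
    simp only [Set.mem_ofPred_eq] at hf hg ⊢
    rw [h]
    exact hf.add hg
  smul_mem' := by
    intro c f hf
    have h : ((c • f : Lp ℂ 2 (volume : Measure ℝ)) : 𝓢'(ℝ, ℂ)) = c • (f : 𝓢'(ℝ, ℂ)) :=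
      map_smul (Lp.toTemperedDistributionCLM ℂ volume 2) c f
    simp only [Set.mem_ofPred_eq] at hf ⊢
    rw [h]
    exact hf.smul c

/-- The Sobolev space `H^s(ℝ; ℂ)`, for `s ≥ 0`. It is a type of its own because it carries the
`H^s` norm and not the norm of `L²`. -/
def Sobolev (s : ℝ) : Type := sobolevSubmodule s

instance (s : ℝ) : AddCommGroup (Sobolev s) :=
  inferInstanceAs (AddCommGroup (sobolevSubmodule s))

instance (s : ℝ) : Module ℂ (Sobolev s) :=
  inferInstanceAs (Module ℂ (sobolevSubmodule s))

/-- The inclusion `H^s(ℝ; ℂ) ⊆ L²(ℝ; ℂ)`. -/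
def toL2 {s : ℝ} : Sobolev s →ₗ[ℂ] Lp ℂ 2 (volume : Measure ℝ) :=
  (sobolevSubmodule s).subtype

theorem toL2_injective {s : ℝ} : Function.Injective (toL2 (s := s)) :=
  Subtype.val_injective

theorem toL2_memSobolev {s : ℝ} (f : Sobolev s) : MemSobolev s 2 (toL2 f : 𝓢'(ℝ, ℂ)) :=
  f.2

theorem toTemperedDistribution_injective :
    Function.Injective (Lp.toTemperedDistributionCLM ℂ (volume : Measure ℝ) 2) :=
  LinearMap.ker_eq_bot.mp Lp.ker_toTemperedDistributionCLM_eq_bot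

/-- The function `𝓕⁻¹ (1 + |ξ|²)^{s/2} 𝓕 f` of `L²`. -/
def besselFun {s : ℝ} (f : Sobolev s) : Lp ℂ 2 (volume : Measure ℝ) :=
  Exists.choose (toL2_memSobolev f)

theorem besselFun_spec {s : ℝ} (f : Sobolev s) :
    Lp.toTemperedDistributionCLM ℂ volume 2 (besselFun f) =
      besselPotential ℝ ℂ s (Lp.toTemperedDistributionCLM ℂ volume 2 (toL2 f)) :=
  (Exists.choose_spec (toL2_memSobolev f)).symm

/-- The Bessel potential `𝓕⁻¹ (1 + |ξ|²)^{s/2} 𝓕` as a linear map from `H^s` to `L²`. -/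
def bessel (s : ℝ) : Sobolev s →ₗ[ℂ] Lp ℂ 2 (volume : Measure ℝ) where
  toFun f := besselFun f
  map_add' f g := by
    apply toTemperedDistribution_injective
    rw [map_add, besselFun_spec, besselFun_spec, besselFun_spec, map_add, map_add, map_add]
  map_smul' c f := by
    apply toTemperedDistribution_injective
    rw [RingHom.id_apply, map_smul, besselFun_spec, besselFun_spec, map_smul, map_smul, map_smul]

theorem bessel_spec {s : ℝ} (f : Sobolev s) :
    besselPotential ℝ ℂ s (toL2 f : 𝓢'(ℝ, ℂ)) = (bessel s f : 𝓢'(ℝ, ℂ)) :=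
  (besselFun_spec f).symm

theorem bessel_injective (s : ℝ) : Function.Injective (bessel s) := by
  intro f g h
  apply toL2_injective
  apply toTemperedDistribution_injective
  simp only [Lp.toTemperedDistributionCLM_apply]
  have hf := (besselPotential_neg_apply_eq_iff s _ _).mpr (bessel_spec f)
  have hg := (besselPotential_neg_apply_eq_iff s _ _).mpr (bessel_spec g)
  rw [← hf, ← hg, h]

/-- The `H^s` norm is `‖f‖ = ‖𝓕⁻¹ (1 + |ξ|²)^{s/2} 𝓕 f‖_{L²}`. -/
instance (s : ℝ) : NormedAddCommGroup (Sobolev s) :=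
  NormedAddCommGroup.induced (Sobolev s) (Lp ℂ 2 (volume : Measure ℝ)) (bessel s)
    (bessel_injective s)

instance (s : ℝ) : NormedSpace ℂ (Sobolev s) :=
  NormedSpace.induced ℂ (Sobolev s) (Lp ℂ 2 (volume : Measure ℝ)) (bessel s)

theorem norm_def {s : ℝ} (f : Sobolev s) : ‖f‖ = ‖bessel s f‖ := rfl

/-- The real part `p` of `u = p + i q`. -/
def realPart {s : ℝ} (u : Sobolev s) : Lp ℝ 2 (volume : Measure ℝ) :=
  Complex.reCLM.compLp (toL2 u)

/-- The imaginary part `q` of `u = p + i q`. -/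
def imagPart {s : ℝ} (u : Sobolev s) : Lp ℝ 2 (volume : Measure ℝ) :=
  Complex.imCLM.compLp (toL2 u)

/-- The charge `Q(u) = ∫ |u|² dx`. -/
def charge {s : ℝ} (u : Sobolev s) : ℝ :=
  ∫ x : ℝ, ‖toL2 u x‖ ^ 2

/-- The nonlinearity `g(z) = |z|^{2σ} z`. -/
def nonlin (σ : ℕ) (z : ℂ) : ℂ :=
  ((‖z‖ ^ (2 * σ) : ℝ) : ℂ) * z

/-- The value `(u + u') / 2`. -/
def midValue {s : ℝ} (u u' : Sobolev s) : Sobolev s :=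
  (1 / 2 : ℂ) • (u + u')

/-- One step of the mid-point scheme: with `m = (u + u') / 2`,
`i (u' - u) / δt + (δW / δt) Δ m + |m|^{2σ} m = 0` in the sense of tempered distributions,
that is, the equation holds when tested against every Schwartz function `φ`.
For `s > 1/2` the function `m` is bounded, so the last integral converges absolutely. -/
def IsMidpointStep {s : ℝ} (σ : ℕ) (δt δW : ℝ) (u u' : Sobolev s) : Prop :=
  ∀ φ : 𝓢(ℝ, ℂ),
    Complex.I * ((toL2 (u' - u) : 𝓢'(ℝ, ℂ)) φ / δt)
      + (δW / δt : ℝ) * (Δ (toL2 (midValue u u') : 𝓢'(ℝ, ℂ))) φ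
      + ∫ x : ℝ, φ x * nonlin σ (toL2 (midValue u u') x) = 0

/-- The time step `δt = T / N`. -/
def timeStep (T : ℝ≥0) (N : ℕ) : ℝ≥0 := T / N

/-- The grid point `t_n = n δt`. -/
def gridPoint (T : ℝ≥0) (N n : ℕ) : ℝ≥0 := n * timeStep T N

/-- The increment `δW_n = W(t_{n+1}) - W(t_n)`. -/
def increment {Ω : Type*} (W : ℝ≥0 → Ω → ℝ) (T : ℝ≥0) (N n : ℕ) (ω : Ω) : ℝ :=
  W (gridPoint T N (n + 1)) ω - W (gridPoint T N n) ω

/-- Along the path `ω`, the sequence `u⁰, …, u^N` solves the mid-point scheme. -/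
def SolvesScheme {s : ℝ} {Ω : Type*} (σ : ℕ) (W : ℝ≥0 → Ω → ℝ) (T : ℝ≥0) (N : ℕ) (ω : Ω)
    (u : ℕ → Sobolev s) : Prop :=
  ∀ n < N, IsMidpointStep σ (timeStep T N) (increment W T N n ω) (u n) (u (n + 1))

/-- Along the path `ω`, the maps `v ↦ Φ n v`, `0 ≤ n ≤ N`, are a phase flow of the mid-point
scheme on the set `D` of initial data: `Φ n v` is the value after `n` steps of a solution of the
scheme which starts in `v`. -/
structure IsSchemeFlow {s : ℝ} {Ω : Type*} (σ : ℕ) (W : ℝ≥0 → Ω → ℝ) (T : ℝ≥0) (N : ℕ) (ω : Ω)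
    (D : Set (Sobolev s)) (Φ : ℕ → Sobolev s → Sobolev s) : Prop where
  isOpen : IsOpen D
  initial : ∀ v ∈ D, Φ 0 v = v
  solves : ∀ v ∈ D, SolvesScheme σ W T N ω (fun n ↦ Φ n v)

/-- The two-form `∫ dp ∧ dq dx` on phase space for `p = Re Ψ` and `q = Im Ψ`, where `Ψ` is a
function of the initial datum `v`, evaluated at `v` on the tangent vectors `h`, `k`. Here `dp`
and `dq` are the Fréchet derivatives of `p` and `q` with respect to the initial datum. -/
def symplecticForm {s : ℝ} (Ψ : Sobolev s → Sobolev s) (v h k : Sobolev s) : ℝ :=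
  let dp := fderiv ℝ (fun w ↦ realPart (Ψ w)) v
  let dq := fderiv ℝ (fun w ↦ imagPart (Ψ w)) v
  ∫ x : ℝ, (dp h x * dq k x - dp k x * dq h x)

end MidpointNLS

end

/-! Both claims are pathwise and reduce to one step of the scheme. Let $(u_j,u_j')$, $j=1,2$,
satisfy the step equation with midpoints $m_j$ and nonlinear terms replaced by $b_j\in L^2$. The
equation forces $\delta W\,\Delta m_j\in L^2$, and on such functions the Laplacian is symmetric,
being a real Fourier multiplier. With the discrete product rule $\langle u_1',u_2'\rangle-\langle
u_1,u_2\rangle=\langle u_1'-u_1,m_2\rangle+\langle m_1,u_2'-u_2\rangle$ this gives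
`inner_sub_inner_eq`: the inner product changes only through $\langle b_1,m_2\rangle-\langle
m_1,b_2\rangle$.

For the charge, both solutions coincide and $\langle |m|^{2\sigma}m,m\rangle$ is real. For the
two-form, which is $\operatorname{Im}\langle du(h),du(k)\rangle$, the step is differentiated
(`linearized_step`), so $b$ becomes the derivative of the nonlinearity at $m$ applied to the
midpoint of the derivatives. The nonlinearity is a gradient, so the real part of the defect vanishes
(`inner_fderiv_nonlin_symm`). The embedding of $H^s$ in $L^\infty$ puts every $b$ in $L^2$ and
dominates the difference quotients. -/

open scoped ContDiff in
/-- Two locally integrable functions which define the same functional on Schwartz functions agree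
almost everywhere. -/
theorem ae_eq_of_integral_schwartz_mul_eq {f g : ℝ → ℂ} (hf : LocallyIntegrable f)
    (hg : LocallyIntegrable g) (h : ∀ φ : 𝓢(ℝ, ℂ), ∫ x, φ x * f x = ∫ x, φ x * g x) :
    f =ᵐ[volume] g := by
  refine ae_eq_of_integral_contDiff_smul_eq hf hg fun φ hφ hc ↦ ?_
  have h₁ : HasCompactSupport (Complex.ofRealCLM ∘ φ) := hc.comp_left rfl
  have h₂ : ContDiff ℝ ∞ (Complex.ofRealCLM ∘ φ) := by fun_prop
  simpa using h (h₁.toSchwartzMap h₂)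

namespace MidpointNLS

/-- If an `L²` function is, as a distribution, the product of an `L²` function with a function of
temperate growth, then it is their product almost everywhere. -/
theorem ae_eq_mul_of_eq_smulLeftCLM {a : ℝ → ℂ} (ha : a.HasTemperateGrowth)
    {f g : Lp ℂ 2 (volume : Measure ℝ)} (h : (g : 𝓢'(ℝ, ℂ)) = smulLeftCLM ℂ a (f : 𝓢'(ℝ, ℂ))) :
    g =ᵐ[volume] fun x ↦ a x * f x := by
  have hloc (u : Lp ℂ 2 (volume : Measure ℝ)) : LocallyIntegrable u :=
    (Lp.memLp u).locallyIntegrable one_le_two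
  refine ae_eq_of_integral_schwartz_mul_eq (hloc g) ?_ fun φ ↦ ?_
  · have := (locallyIntegrableOn_univ.2 (hloc f)).continuousOn_mul
      ha.1.continuous.continuousOn isOpen_univ.isLocallyClosed
    exact locallyIntegrableOn_univ.1 this
  · have := DFunLike.congr_fun h φ
    simpa [SchwartzMap.smulLeftCLM_apply_apply ha, mul_assoc, mul_left_comm] using this

/-! ### Fourier side of $H^s$ and the Sobolev embedding -/

section Embedding

open FourierTransform

theorem hasTemperateGrowth_bracket (r : ℝ) :
    (fun ξ : ℝ ↦ (((1 + ‖ξ‖ ^ 2) ^ r : ℝ) : ℂ)).HasTemperateGrowth := by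
  fun_prop

theorem fourier_bessel_ae {s : ℝ} (f : Sobolev s) :
    (𝓕 (bessel s f) : Lp ℂ 2 (volume : Measure ℝ)) =ᵐ[volume]
      fun ξ ↦ (((1 + ‖ξ‖ ^ 2) ^ (s / 2) : ℝ) : ℂ) * 𝓕 (toL2 f) ξ := by
  refine ae_eq_mul_of_eq_smulLeftCLM (hasTemperateGrowth_bracket _) ?_
  rw [← Lp.fourier_toTemperedDistribution_eq, ← Lp.fourier_toTemperedDistribution_eq,
    ← bessel_spec, fourier_besselPotential_eq_smulLeftCLM_fourier_apply]

theorem norm_toL2_le {s : ℝ} (hs : 0 ≤ s) (f : Sobolev s) : ‖toL2 f‖ ≤ ‖f‖ := by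
  rw [norm_def, ← Lp.norm_fourier_eq, ← Lp.norm_fourier_eq (bessel s f)]
  refine Lp.norm_le_norm_of_ae_le ?_
  filter_upwards [fourier_bessel_ae f] with ξ hξ
  rw [hξ, norm_mul, Complex.norm_real, Real.norm_of_nonneg (by positivity)]
  exact le_mul_of_one_le_left (norm_nonneg _)
    (Real.one_le_rpow (by nlinarith [norm_nonneg ξ]) (by positivity))

/-- The inclusion `H^s ⊆ L²` as a continuous linear map. -/
noncomputable def toL2CLM {s : ℝ} (hs : 0 ≤ s) : Sobolev s →L[ℂ] Lp ℂ 2 (volume : Measure ℝ) :=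
  toL2.mkContinuous 1 fun f ↦ by simpa using norm_toL2_le hs f

theorem memLp_bracket {s : ℝ} (hs : 1 / 2 < s) :
    MemLp (fun ξ : ℝ ↦ (((1 + ‖ξ‖ ^ 2) ^ (-s / 2) : ℝ) : ℂ)) 2 := by
  rw [← memLp_norm_iff (hasTemperateGrowth_bracket _).1.continuous.aestronglyMeasurable,
    memLp_two_iff_integrable_sq (by
      exact (hasTemperateGrowth_bracket _).1.continuous.norm.aestronglyMeasurable)]
  -- The squared weight is $(1+|\xi|^2)^{-r/2}$ with $r=2s$; integrability needs $r$ above the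
  -- dimension $1$.
  have := integrable_rpow_neg_one_add_norm_sq (E := ℝ) (μ := volume) (r := 2 * s)
    (by simp; linarith)
  refine this.congr (.of_forall fun ξ ↦ ?_)
  beta_reduce
  rw [Complex.norm_real, Real.norm_of_nonneg (by positivity : 0 ≤ (1 + ‖ξ‖ ^ 2) ^ (-s / 2)),
    ← Real.rpow_mul_natCast (by positivity)]
  congr 1
  push_cast
  ring

theorem fourier_toL2_ae {s : ℝ} (f : Sobolev s) :
    (𝓕 (toL2 f) : Lp ℂ 2 (volume : Measure ℝ)) =ᵐ[volume]
      fun ξ ↦ (((1 + ‖ξ‖ ^ 2) ^ (-s / 2) : ℝ) : ℂ) * 𝓕 (bessel s f) ξ := by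
  filter_upwards [fourier_bessel_ae f] with ξ hξ
  rw [hξ, ← mul_assoc, ← Complex.ofReal_mul, ← Real.rpow_add (by positivity)]
  simp [neg_div]

theorem integrable_fourier_toL2 {s : ℝ} (hs : 1 / 2 < s) (f : Sobolev s) :
    Integrable (𝓕 (toL2 f) : Lp ℂ 2 (volume : Measure ℝ)) :=
  ((memLp_bracket hs).integrable_mul (Lp.memLp (𝓕 (bessel s f)))).congr (fourier_toL2_ae f).symm

/-- Cauchy–Schwarz for the weight $(1+|\xi|^2)^{-s/2}$ and the transform of the Bessel potential,
whose $L^2$ norm is the $H^s$ norm by Plancherel. -/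
theorem integral_norm_fourier_toL2_le {s : ℝ} (hs : 1 / 2 < s) :
    ∃ C : ℝ, 0 ≤ C ∧ ∀ f : Sobolev s, ∫ ξ, ‖(𝓕 (toL2 f) : Lp ℂ 2 (volume : Measure ℝ)) ξ‖ ≤
      C * ‖f‖ := by
  set b := (memLp_bracket hs).norm.toLp
  refine ⟨‖b‖, norm_nonneg _, fun f ↦ ?_⟩
  set F := 𝓕 (bessel s f)
  set c := (Lp.memLp F).norm.toLp
  have hc : ‖c‖ = ‖f‖ := by
    rw [norm_def, ← Lp.norm_fourier_eq (bessel s f), Lp.norm_toLp, eLpNorm_norm, Lp.norm_def]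
  calc _ = inner ℝ b c := by
        rw [L2.inner_def]
        refine integral_congr_ae ?_
        filter_upwards [fourier_toL2_ae f, (memLp_bracket hs).norm.coeFn_toLp,
          (Lp.memLp F).norm.coeFn_toLp] with ξ h₁ h₂ h₃
        rw [h₁, h₂, h₃, norm_mul]
        simp [F, mul_comm]
    _ ≤ ‖b‖ * ‖c‖ := real_inner_le_norm _ _
    _ = _ := by rw [hc]

/-- Identifies the abstract $L^2$ inversion with the inverse Fourier integral, which is bounded by
the $L^1$ norm of the transform. -/
theorem toL2_ae_eq_fourierInv {s : ℝ} (hs : 1 / 2 < s) (f : Sobolev s) :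
    toL2 f =ᵐ[volume] 𝓕⁻ ((𝓕 (toL2 f) : Lp ℂ 2 (volume : Measure ℝ)) : ℝ → ℂ) := by
  have hint := integrable_fourier_toL2 hs f
  set F := (𝓕 (toL2 f) : Lp ℂ 2 (volume : Measure ℝ)) with hF
  have hcont : Continuous (𝓕⁻ (F : ℝ → ℂ)) := by
    have : 𝓕⁻ (F : ℝ → ℂ) = fun x ↦ 𝓕 (F : ℝ → ℂ) (-x) := by
      ext x; rw [Real.fourierInv_eq_fourier_neg]
    rw [this]
    exact (VectorFourier.fourierIntegral_continuous Real.continuous_fourierChar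
      (innerSL ℝ).continuous₂ hint).comp continuous_neg
  refine ae_eq_of_integral_schwartz_mul_eq ((Lp.memLp _).locallyIntegrable one_le_two)
    hcont.locallyIntegrable fun φ ↦ ?_
  have h₁ : (toL2 f : 𝓢'(ℝ, ℂ)) φ = (F : 𝓢'(ℝ, ℂ)) (𝓕⁻ φ) := by
    rw [← TemperedDistribution.fourierInv_apply, hF, ← Lp.fourier_toTemperedDistribution_eq,
      fourierInv_fourier_eq]
  simp only [Lp.toTemperedDistribution_apply, smul_eq_mul] at h₁
  rw [h₁]
  -- The negated pairing turns the Fourier kernel into the inverse one.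
  have h₂ := VectorFourier.integral_fourierIntegral_smul_eq_flip (μ := volume) (ν := volume)
    (L := -innerₗ ℝ) Real.continuous_fourierChar
    (by exact (continuous_inner (𝕜 := ℝ) (E := ℝ)).neg) φ.integrable hint
  simp only [smul_eq_mul] at h₂
  have e₁ (ξ : ℝ) : (𝓕⁻ φ) ξ = VectorFourier.fourierIntegral 𝐞 volume (-innerₗ ℝ) φ ξ := by
    rw [SchwartzMap.fourierInv_coe, Real.fourierInv_eq]
    simp [VectorFourier.fourierIntegral]
  have e₂ (ξ : ℝ) : (𝓕⁻ (F : ℝ → ℂ)) ξ =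
      VectorFourier.fourierIntegral 𝐞 volume (-innerₗ ℝ).flip F ξ := by
    rw [Real.fourierInv_eq]
    simp [VectorFourier.fourierIntegral, mul_comm]
  simp only [e₁, e₂]
  exact h₂

/-- The Sobolev embedding `H^s(ℝ) ⊆ L^∞(ℝ)` for `s > 1/2`. -/
theorem exists_ae_norm_toL2_le {s : ℝ} (hs : 1 / 2 < s) :
    ∃ C : ℝ, 0 ≤ C ∧ ∀ f : Sobolev s, ∀ᵐ x, ‖toL2 f x‖ ≤ C * ‖f‖ := by
  obtain ⟨C, hC, h⟩ := integral_norm_fourier_toL2_le hs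
  refine ⟨C, hC, fun f ↦ ?_⟩
  filter_upwards [toL2_ae_eq_fourierInv hs f] with x hx
  rw [hx, Real.fourierInv_eq_fourier_neg]
  exact (VectorFourier.norm_fourierIntegral_le_integral_norm _ _ _ _ _).trans (h f)

end Embedding

/-! ### Symmetry of the Laplacian -/

section Laplacian

open FourierTransform

/-- The distributional Laplacian is symmetric on the `L²` functions which it maps to `L²`. -/
theorem inner_eq_inner_of_eq_smul_laplacian {f₁ f₂ g₁ g₂ : Lp ℂ 2 (volume : Measure ℝ)} (c : ℝ)
    (h₁ : (g₁ : 𝓢'(ℝ, ℂ)) = (c : ℂ) • Δ (f₁ : 𝓢'(ℝ, ℂ)))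
    (h₂ : (g₂ : 𝓢'(ℝ, ℂ)) = (c : ℂ) • Δ (f₂ : 𝓢'(ℝ, ℂ))) :
    inner ℂ f₁ g₂ = inner ℂ g₁ f₂ := by
  have key {f g : Lp ℂ 2 (volume : Measure ℝ)}
      (h : (g : 𝓢'(ℝ, ℂ)) = (c : ℂ) • Δ (f : 𝓢'(ℝ, ℂ))) :
      (𝓕 g : Lp ℂ 2 (volume : Measure ℝ)) =ᵐ[volume]
        fun ξ ↦ ((c * -(2 * Real.pi) ^ 2 * ‖ξ‖ ^ 2 : ℝ) : ℂ) * 𝓕 f ξ := by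
    have hg : (fun ξ : ℝ ↦ ((‖ξ‖ ^ 2 : ℝ) : ℂ)).HasTemperateGrowth := by fun_prop
    have ha : (fun ξ : ℝ ↦ ((c * -(2 * Real.pi) ^ 2 * ‖ξ‖ ^ 2 : ℝ) : ℂ)) =
        ((c * -(2 * Real.pi) ^ 2 : ℝ) : ℂ) • fun ξ : ℝ ↦ ((‖ξ‖ ^ 2 : ℝ) : ℂ) := by
      ext ξ; simp
    refine ae_eq_mul_of_eq_smulLeftCLM (ha ▸ by fun_prop) ?_
    rw [← Lp.fourier_toTemperedDistribution_eq, ← Lp.fourier_toTemperedDistribution_eq, h,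
      laplacian_eq_fourierMultiplierCLM, ha, smulLeftCLM_smul hg, ← Complex.coe_smul,
      smul_smul, FourierTransform.fourier_smul, TemperedDistribution.fourierMultiplierCLM_apply,
      fourier_fourierInv_eq]
    simp
  rw [← Lp.inner_fourier_eq f₁, ← Lp.inner_fourier_eq g₁, L2.inner_def, L2.inner_def]
  refine integral_congr_ae ?_
  filter_upwards [key h₁, key h₂] with ξ e₁ e₂
  rw [e₁, e₂]
  simp only [RCLike.inner_apply, map_mul, Complex.conj_ofReal]
  ring

end Laplacian

end MidpointNLS

namespace MidpointNLS

/-! ### The nonlinearity and its derivative -/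

section Nonlinearity

open Filter Topology

theorem nonlin_eq_smul (σ : ℕ) : nonlin σ = fun z ↦ (‖z‖ ^ 2) ^ σ • z := by
  ext z
  simp [nonlin, pow_mul]

theorem contDiff_nonlin (σ : ℕ) : ContDiff ℝ 1 (nonlin σ) := by
  rw [nonlin_eq_smul]
  exact ((contDiff_norm_sq ℝ).pow σ).smul contDiff_id

theorem hasFDerivAt_nonlin (σ : ℕ) (z : ℂ) :
    HasFDerivAt (nonlin σ) (fderiv ℝ (nonlin σ) z) z :=
  ((contDiff_nonlin σ).differentiable one_ne_zero z).hasFDerivAt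

/-- For `σ = 0` the truncated exponent `σ - 1` is harmless because of the factor `σ`. -/
theorem fderiv_nonlin_apply (σ : ℕ) (z w : ℂ) :
    fderiv ℝ (nonlin σ) z w =
      (‖z‖ ^ 2) ^ σ • w + (σ * (‖z‖ ^ 2) ^ (σ - 1) * (2 * inner ℝ z w)) • z := by
  have h := (((hasFDerivAt_id (𝕜 := ℝ) z).norm_sq).pow σ).smul (hasFDerivAt_id (𝕜 := ℝ) z)
  have e : nonlin σ = fun y ↦ (‖id y‖ ^ 2) ^ σ • id y := nonlin_eq_smul σ
  rw [e]
  refine (DFunLike.congr_fun h.fderiv w).trans ?_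
  simp [mul_add]

/-- The nonlinearity is a gradient: its derivative is symmetric for the real inner product. -/
theorem inner_fderiv_nonlin_symm (σ : ℕ) (z v w : ℂ) :
    inner ℝ v (fderiv ℝ (nonlin σ) z w) = inner ℝ (fderiv ℝ (nonlin σ) z v) w := by
  simp only [fderiv_nonlin_apply, inner_add_left, inner_add_right, inner_smul_left,
    inner_smul_right, real_inner_comm v z, conj_trivial]
  ring

theorem continuous_fderiv_nonlin_apply (σ : ℕ) :
    Continuous fun p : ℂ × ℂ ↦ fderiv ℝ (nonlin σ) p.1 p.2 :=
  (contDiff_nonlin σ).continuous_fderiv_apply one_ne_zero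

theorem exists_norm_fderiv_nonlin_le (σ : ℕ) (R : ℝ) :
    ∃ K : ℝ≥0, ∀ z, ‖z‖ ≤ R → ‖fderiv ℝ (nonlin σ) z‖ ≤ K := by
  obtain ⟨K, hK⟩ := (isCompact_closedBall (0 : ℂ) R).exists_bound_of_continuousOn
    ((contDiff_nonlin σ).continuous_fderiv one_ne_zero).continuousOn
  exact ⟨K.toNNReal, fun z hz ↦ (hK z (by simpa using hz)).trans (Real.le_coe_toNNReal K)⟩

theorem exists_norm_nonlin_sub_le (σ : ℕ) (R : ℝ) :
    ∃ K : ℝ≥0, ∀ z w, ‖z‖ ≤ R → ‖w‖ ≤ R → ‖nonlin σ z - nonlin σ w‖ ≤ K * ‖z - w‖ := by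
  obtain ⟨K, hK⟩ := exists_norm_fderiv_nonlin_le σ R
  refine ⟨K, fun z w hz hw ↦ ?_⟩
  exact (convex_closedBall (0 : ℂ) R).norm_image_sub_le_of_norm_fderiv_le
    (fun x _ ↦ (contDiff_nonlin σ).differentiable one_ne_zero x)
    (fun x hx ↦ hK x (by simpa using hx)) (by simpa using hw) (by simpa using hz)

/-- The nonlinearity vanishes at $0$ and is Lipschitz on bounded sets. -/
theorem memLp_nonlin (σ : ℕ) {f : ℝ → ℂ} (hf : MemLp f 2) {R : ℝ} (hR : ∀ᵐ x, ‖f x‖ ≤ R) :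
    MemLp (fun x ↦ nonlin σ (f x)) 2 := by
  obtain ⟨K, hK⟩ := exists_norm_nonlin_sub_le σ R
  refine hf.of_le_mul (c := K)
    ((contDiff_nonlin σ).continuous.comp_aestronglyMeasurable hf.1) ?_
  filter_upwards [hR] with x hx
  simpa [nonlin] using hK (f x) 0 hx (by simpa using (norm_nonneg _).trans hx)

theorem memLp_fderiv_nonlin (σ : ℕ) {f g : ℝ → ℂ} (hf : AEStronglyMeasurable f) {R : ℝ}
    (hR : ∀ᵐ x, ‖f x‖ ≤ R) (hg : MemLp g 2) :
    MemLp (fun x ↦ fderiv ℝ (nonlin σ) (f x) (g x)) 2 := by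
  obtain ⟨K, hK⟩ := exists_norm_fderiv_nonlin_le σ R
  refine hg.of_le_mul (c := K)
    ((continuous_fderiv_nonlin_apply σ).comp_aestronglyMeasurable (hf.prodMk hg.1)) ?_
  filter_upwards [hR] with x hx
  exact (ContinuousLinearMap.le_opNorm _ _).trans (by gcongr; exact hK _ hx)

theorem toL2_sub_ae {s : ℝ} (f g : Sobolev s) :
    toL2 (f - g) =ᵐ[volume] fun x ↦ toL2 f x - toL2 g x := by
  rw [map_sub]
  exact Lp.coeFn_sub _ _

theorem toL2_real_smul_ae {s : ℝ} (c : ℝ) (f : Sobolev s) :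
    toL2 (c • f) =ᵐ[volume] fun x ↦ c • toL2 f x := by
  have : toL2 (c • f) = c • toL2 f := toL2.map_smul (c : ℂ) f
  rw [this]
  exact Lp.coeFn_smul _ _

theorem memLp_nonlin_toL2 {s : ℝ} (hs : 1 / 2 < s) (σ : ℕ) (f : Sobolev s) :
    MemLp (fun x ↦ nonlin σ (toL2 f x)) 2 := by
  obtain ⟨C, -, hC⟩ := exists_ae_norm_toL2_le hs
  exact memLp_nonlin σ (Lp.memLp _) (hC f)

theorem memLp_fderiv_nonlin_toL2 {s : ℝ} (hs : 1 / 2 < s) (σ : ℕ) (f g : Sobolev s) :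
    MemLp (fun x ↦ fderiv ℝ (nonlin σ) (toL2 f x) (toL2 g x)) 2 := by
  obtain ⟨C, -, hC⟩ := exists_ae_norm_toL2_le hs
  exact memLp_fderiv_nonlin σ (Lp.memLp _).1 (hC f) (Lp.memLp _)

/-- Differentiation of the nonlinear term along a differentiable curve in `H^s`, tested against a
Schwartz function. -/
theorem hasDerivAt_integral_nonlin {s : ℝ} (hs : 1 / 2 < s) (σ : ℕ) (φ : 𝓢(ℝ, ℂ))
    {γ : ℝ → Sobolev s} {M : Sobolev s} {t₀ : ℝ} (hγ : HasDerivAt γ M t₀) :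
    HasDerivAt (fun t ↦ ∫ x, φ x * nonlin σ (toL2 (γ t) x))
      (∫ x, φ x * fderiv ℝ (nonlin σ) (toL2 (γ t₀) x) (toL2 M x)) t₀ := by
  obtain ⟨C, hC₀, hC⟩ := exists_ae_norm_toL2_le hs
  have hint (f : Sobolev s) : Integrable fun x ↦ φ x * nonlin σ (toL2 f x) :=
    (φ.memLp 2).integrable_mul (memLp_nonlin_toL2 hs σ f)
  -- Near $t_0$ the curve has norm at most `‖γ t₀‖ + 1`, so its values lie almost everywhere in this
  -- ball.
  obtain ⟨K, hK⟩ := exists_norm_nonlin_sub_le σ (C * (‖γ t₀‖ + 1))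
  rw [hasDerivAt_iff_tendsto_slope] at hγ ⊢
  -- Along a sequence, only countably many null sets have to be discarded.
  refine tendsto_of_seq_tendsto fun τ hτ ↦ ?_
  have hτ₀ : Tendsto τ atTop (𝓝 t₀) := hτ.mono_right nhdsWithin_le_nhds
  have hslope : Tendsto (fun k ↦ slope γ t₀ (τ k)) atTop (𝓝 M) := hγ.comp hτ
  have hcont : Tendsto (fun k ↦ γ (τ k)) atTop (𝓝 (γ t₀)) :=
    (hasDerivAt_iff_tendsto_slope.2 hγ).continuousAt.tendsto.comp hτ₀
  have hdiff (k : ℕ) : slope (fun t ↦ ∫ x, φ x * nonlin σ (toL2 (γ t) x)) t₀ (τ k) =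
      ∫ x, φ x * ((τ k - t₀)⁻¹ • (nonlin σ (toL2 (γ (τ k)) x) - nonlin σ (toL2 (γ t₀) x))) := by
    rw [slope_def_module, ← integral_sub (hint _) (hint _), ← integral_smul]
    refine integral_congr_ae (.of_forall fun x ↦ ?_)
    simp only [Complex.real_smul]
    ring
  have hquot : ∀ᵐ x, ∀ k, toL2 (slope γ t₀ (τ k)) x =
      (τ k - t₀)⁻¹ • (toL2 (γ (τ k)) x - toL2 (γ t₀) x) := by
    refine ae_all_iff.2 fun k ↦ ?_
    rw [slope_def_module]
    filter_upwards [toL2_real_smul_ae (τ k - t₀)⁻¹ (γ (τ k) - γ t₀),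
      toL2_sub_ae (γ (τ k)) (γ t₀)] with x h₁ h₂
    rw [h₁, h₂]
  -- The $L^\infty$ bound gives pointwise convergence of the whole sequence, without extracting a
  -- subsequence.
  have hlim {f : ℕ → Sobolev s} {g : Sobolev s} (h : Tendsto f atTop (𝓝 g)) :
      ∀ᵐ x, Tendsto (fun k ↦ toL2 (f k) x) atTop (𝓝 (toL2 g x)) := by
    filter_upwards [ae_all_iff.2 fun k ↦ hC (f k - g), ae_all_iff.2 fun k ↦ toL2_sub_ae (f k) g]
      with x h₁ h₂
    rw [tendsto_iff_norm_sub_tendsto_zero] at h ⊢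
    refine squeeze_zero (fun _ ↦ norm_nonneg _) (fun k ↦ ?_) (by simpa using h.const_mul C)
    rw [← h₂ k]
    exact h₁ k
  simp only [Function.comp_def, hdiff]
  refine tendsto_integral_filter_of_dominated_convergence
    (fun x ↦ ‖φ x‖ * (K * (C * (‖M‖ + 1)))) (.of_forall fun k ↦ ?_) ?_
    (φ.integrable.norm.mul_const _) ?_
  · exact φ.continuous.aestronglyMeasurable.mul
      (((memLp_nonlin_toL2 hs σ (γ (τ k))).1.sub (memLp_nonlin_toL2 hs σ (γ t₀)).1).const_smul
        (τ k - t₀)⁻¹)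
  · filter_upwards [hcont.norm.eventually_le_const (lt_add_one _),
      hslope.norm.eventually_le_const (lt_add_one _)] with k hk₁ hk₂
    filter_upwards [hquot, hC (γ (τ k)), hC (γ t₀), hC (slope γ t₀ (τ k))] with x h₁ h₂ h₃ h₄
    rw [norm_mul]
    gcongr
    calc _ = ‖(τ k - t₀)⁻¹‖ * ‖nonlin σ (toL2 (γ (τ k)) x) - nonlin σ (toL2 (γ t₀) x)‖ :=
          norm_smul _ _
      _ ≤ ‖(τ k - t₀)⁻¹‖ * (K * ‖toL2 (γ (τ k)) x - toL2 (γ t₀) x‖) := by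
          gcongr
          exact hK _ _ (h₂.trans (by gcongr)) (h₃.trans (by gcongr; linarith))
      _ = K * ‖toL2 (slope γ t₀ (τ k)) x‖ := by rw [h₁ k, norm_smul]; ring
      _ ≤ _ := by gcongr; exact h₄.trans (by gcongr)
  · filter_upwards [hquot, hlim hcont, hlim hslope] with x h₁ h₂ h₃
    refine Tendsto.const_mul _ ?_
    have := (hasFDerivWithinAt_univ.2 (hasFDerivAt_nonlin σ (toL2 (γ t₀) x))).lim (l := atTop)
      (c := fun k ↦ (τ k - t₀)⁻¹) (d := fun k ↦ toL2 (γ (τ k)) x - toL2 (γ t₀) x)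
      (by simpa using h₂.sub_const (toL2 (γ t₀) x)) (.of_forall fun _ ↦ Set.mem_univ _)
      (by simpa only [h₁] using h₃)
    simpa using this

end Nonlinearity

end MidpointNLS

namespace MidpointNLS

/-! ### One step, its charge and its linearization -/

section Step

open Filter Topology Complex

/-- If the equation of one step of the scheme holds weakly for `d`, `m`, `b`, then
`δW Δ m = -(i d + δt b)`. -/
theorem toTemperedDistribution_eq_smul_laplacian {δt δW : ℝ} (hδ : δt ≠ 0)
    {d m b : Lp ℂ 2 (volume : Measure ℝ)}
    (h : ∀ φ : 𝓢(ℝ, ℂ), I * ((d : 𝓢'(ℝ, ℂ)) φ / δt)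
      + (δW / δt : ℝ) * (Δ (m : 𝓢'(ℝ, ℂ))) φ + (b : 𝓢'(ℝ, ℂ)) φ = 0) :
    ((-(I • d + (δt : ℂ) • b) : Lp ℂ 2 (volume : Measure ℝ)) : 𝓢'(ℝ, ℂ)) =
      (δW : ℂ) • Δ (m : 𝓢'(ℝ, ℂ)) := by
  have hδ' : (δt : ℂ) ≠ 0 := by exact_mod_cast hδ
  have e := map_neg (Lp.toTemperedDistributionCLM ℂ (volume : Measure ℝ) 2)
    (I • d + (δt : ℂ) • b)
  rw [map_add, map_smul, map_smul] at e
  simp only [Lp.toTemperedDistributionCLM_apply] at e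
  rw [e]
  ext φ
  have hφ := h φ
  push_cast at hφ
  field_simp at hφ
  change -(I * (d : 𝓢'(ℝ, ℂ)) φ + δt * (b : 𝓢'(ℝ, ℂ)) φ) = δW * (Δ (m : 𝓢'(ℝ, ℂ))) φ
  linear_combination -hφ

/-- The change of the inner product of two solutions of the equation of one step with different
nonlinear terms. -/
theorem inner_sub_inner_eq {δt δW : ℝ} (hδ : δt ≠ 0)
    {u₁ u₁' u₂ u₂' m₁ m₂ b₁ b₂ : Lp ℂ 2 (volume : Measure ℝ)}
    (hm₁ : m₁ = (1 / 2 : ℂ) • (u₁ + u₁')) (hm₂ : m₂ = (1 / 2 : ℂ) • (u₂ + u₂'))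
    (h₁ : ∀ φ : 𝓢(ℝ, ℂ), I * (((u₁' - u₁ : Lp ℂ 2 (volume : Measure ℝ)) : 𝓢'(ℝ, ℂ)) φ / δt)
      + (δW / δt : ℝ) * (Δ (m₁ : 𝓢'(ℝ, ℂ))) φ + (b₁ : 𝓢'(ℝ, ℂ)) φ = 0)
    (h₂ : ∀ φ : 𝓢(ℝ, ℂ), I * (((u₂' - u₂ : Lp ℂ 2 (volume : Measure ℝ)) : 𝓢'(ℝ, ℂ)) φ / δt)
      + (δW / δt : ℝ) * (Δ (m₂ : 𝓢'(ℝ, ℂ))) φ + (b₂ : 𝓢'(ℝ, ℂ)) φ = 0) :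
    I * (inner ℂ u₁' u₂' - inner ℂ u₁ u₂) = δt * (inner ℂ b₁ m₂ - inner ℂ m₁ b₂) := by
  have h := inner_eq_inner_of_eq_smul_laplacian δW
    (toTemperedDistribution_eq_smul_laplacian hδ h₁)
    (toTemperedDistribution_eq_smul_laplacian hδ h₂)
  simp only [inner_neg_left, inner_neg_right, inner_add_left, inner_add_right, inner_smul_left,
    inner_smul_right, conj_I, conj_ofReal, inner_sub_left, inner_sub_right] at h
  have e₁ (y : Lp ℂ 2 (volume : Measure ℝ)) :
      inner ℂ m₁ y = 1 / 2 * (inner ℂ u₁ y + inner ℂ u₁' y) := by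
    rw [hm₁, inner_smul_left, inner_add_left, map_div₀, map_one, map_ofNat]
  have e₂ (y : Lp ℂ 2 (volume : Measure ℝ)) :
      inner ℂ y m₂ = 1 / 2 * (inner ℂ y u₂ + inner ℂ y u₂') := by
    rw [hm₂, inner_smul_right, inner_add_right]
  rw [e₁ u₂, e₁ u₂', e₂ u₁, e₂ u₁'] at h
  linear_combination -h

theorem toL2_midValue {s : ℝ} (u u' : Sobolev s) :
    toL2 (midValue u u') = (1 / 2 : ℂ) • (toL2 u + toL2 u') := by
  rw [midValue, map_smul, map_add]

theorem toTemperedDistribution_toLp_apply {f : ℝ → ℂ} (hf : MemLp f 2) (φ : 𝓢(ℝ, ℂ)) :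
    (hf.toLp f : 𝓢'(ℝ, ℂ)) φ = ∫ x, φ x * f x := by
  rw [Lp.toTemperedDistribution_apply]
  refine integral_congr_ae ?_
  filter_upwards [hf.coeFn_toLp] with x hx
  rw [hx, smul_eq_mul]

theorem charge_eq_inner {s : ℝ} (u : Sobolev s) : (charge u : ℂ) = inner ℂ (toL2 u) (toL2 u) := by
  rw [charge, L2.inner_def, ← integral_complex_ofReal]
  simp [inner_self_eq_norm_sq_to_K]

/-- One step of the scheme preserves the charge. -/
theorem IsMidpointStep.charge_eq {s : ℝ} (hs : 1 / 2 < s) {σ : ℕ} {δt δW : ℝ} (hδ : δt ≠ 0)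
    {u u' : Sobolev s} (h : IsMidpointStep σ δt δW u u') : charge u' = charge u := by
  have hb := memLp_nonlin_toL2 hs σ (midValue u u')
  have hw : ∀ φ : 𝓢(ℝ, ℂ),
      I * (((toL2 u' - toL2 u : Lp ℂ 2 (volume : Measure ℝ)) : 𝓢'(ℝ, ℂ)) φ / δt)
        + (δW / δt : ℝ) * (Δ (toL2 (midValue u u') : 𝓢'(ℝ, ℂ))) φ
        + (hb.toLp _ : 𝓢'(ℝ, ℂ)) φ = 0 := fun φ ↦ by
    rw [toTemperedDistribution_toLp_apply, ← map_sub]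
    exact h φ
  have key := inner_sub_inner_eq hδ (toL2_midValue u u') (toL2_midValue u u') hw hw
  -- Both integrands equal the real function $|m|^{2\sigma+2}$.
  have hsymm : inner ℂ (hb.toLp _) (toL2 (midValue u u')) =
      inner ℂ (toL2 (midValue u u')) (hb.toLp _) := by
    rw [L2.inner_def, L2.inner_def]
    refine integral_congr_ae ?_
    filter_upwards [hb.coeFn_toLp] with x hx
    rw [hx]
    simp only [nonlin, RCLike.inner_apply, map_mul, conj_ofReal]
    ring
  rw [hsymm, sub_self, mul_zero, ← charge_eq_inner, ← charge_eq_inner, mul_eq_zero,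
    or_iff_right I_ne_zero, sub_eq_zero] at key
  exact_mod_cast key

/-- Pairing with a Schwartz function, as a continuous linear functional on `H^s`. -/
noncomputable def pairingCLM {s : ℝ} (hs : 0 ≤ s) (φ : 𝓢(ℝ, ℂ)) : Sobolev s →L[ℂ] ℂ :=
  (PointwiseConvergenceCLM.evalCLM (RingHom.id ℂ) ℂ φ).comp
    ((Lp.toTemperedDistributionCLM ℂ volume 2).comp (toL2CLM hs))

theorem hasDerivAt_pairing {s : ℝ} (hs : 0 ≤ s) (φ : 𝓢(ℝ, ℂ)) {γ : ℝ → Sobolev s}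
    {M : Sobolev s} {t₀ : ℝ} (hγ : HasDerivAt γ M t₀) :
    HasDerivAt (fun t ↦ (toL2 (γ t) : 𝓢'(ℝ, ℂ)) φ) ((toL2 M : 𝓢'(ℝ, ℂ)) φ) t₀ :=
  ((pairingCLM hs φ).restrictScalars ℝ).hasFDerivAt.comp_hasDerivAt t₀ hγ

/-- The linearization of one step of the scheme along a curve of solutions. -/
theorem linearized_step {s : ℝ} (hs : 1 / 2 < s) {σ : ℕ} {δt δW : ℝ} {γ γ' : ℝ → Sobolev s}
    {a a' : Sobolev s} {t₀ : ℝ} (hγ : HasDerivAt γ a t₀) (hγ' : HasDerivAt γ' a' t₀)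
    (h : ∀ᶠ t in 𝓝 t₀, IsMidpointStep σ δt δW (γ t) (γ' t)) (φ : 𝓢(ℝ, ℂ)) :
    I * ((toL2 (a' - a) : 𝓢'(ℝ, ℂ)) φ / δt)
      + (δW / δt : ℝ) * (Δ (toL2 (midValue a a') : 𝓢'(ℝ, ℂ))) φ
      + ∫ x, φ x * fderiv ℝ (nonlin σ) (toL2 (midValue (γ t₀) (γ' t₀)) x)
          (toL2 (midValue a a') x) = 0 := by
  have hs₀ : 0 ≤ s := by linarith
  have hmid : HasDerivAt (fun t ↦ midValue (γ t) (γ' t)) (midValue a a') t₀ :=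
    (hγ.add hγ').const_smul (1 / 2 : ℂ)
  have h₁ := hasDerivAt_pairing hs₀ φ (hγ'.sub hγ)
  have h₂ := hasDerivAt_pairing hs₀ (Δ φ) hmid
  have h₃ := hasDerivAt_integral_nonlin hs σ φ hmid
  have hsum := (((h₁.div_const (δt : ℂ)).const_mul I).add
    (h₂.const_mul ((δW / δt : ℝ) : ℂ))).add h₃
  rw [laplacian_apply_apply]
  -- The left side of the step equation vanishes for all $t$ near $t_0$, so its derivative is zero.
  refine hsum.unique ((hasDerivAt_const t₀ (0 : ℂ)).congr_of_eventuallyEq ?_)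
  filter_upwards [h] with t ht
  have := ht φ
  rw [laplacian_apply_apply] at this
  exact this

end Step

/-! ### The symplectic form -/

section Symplectic

open Complex

theorem hasFDerivAt_toL2 {s : ℝ} (hs : 0 ≤ s) {Ψ : Sobolev s → Sobolev s} {v : Sobolev s}
    (hΨ : DifferentiableAt ℝ Ψ v) :
    HasFDerivAt (fun w ↦ toL2 (Ψ w))
      (((toL2CLM hs).restrictScalars ℝ).comp (fderiv ℝ Ψ v)) v :=
  ((toL2CLM hs).restrictScalars ℝ).hasFDerivAt.comp v hΨ.hasFDerivAt

theorem fderiv_compLp_toL2_apply {s : ℝ} (hs : 0 ≤ s) (L : ℂ →L[ℝ] ℝ)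
    {Ψ : Sobolev s → Sobolev s} {v : Sobolev s} (hΨ : DifferentiableAt ℝ Ψ v) (h : Sobolev s) :
    fderiv ℝ (fun w ↦ L.compLp (toL2 (Ψ w))) v h = L.compLp (toL2 (fderiv ℝ Ψ v h)) :=
  DFunLike.congr_fun
    ((L.compLpL 2 (volume : Measure ℝ)).hasFDerivAt.comp v (hasFDerivAt_toL2 hs hΨ)).fderiv h

/-- The symplectic form is the imaginary part of the `L²` inner product of the derivatives. -/
theorem symplecticForm_eq_im_inner {s : ℝ} (hs : 0 ≤ s) {Ψ : Sobolev s → Sobolev s}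
    {v : Sobolev s} (hΨ : DifferentiableAt ℝ Ψ v) (h k : Sobolev s) :
    symplecticForm Ψ v h k =
      (inner ℂ (toL2 (fderiv ℝ Ψ v h)) (toL2 (fderiv ℝ Ψ v k))).im := by
  rw [L2.inner_def]
  refine Eq.trans ?_ (integral_im (𝕜 := ℂ) (L2.integrable_inner _ _))
  simp only [symplecticForm, realPart, imagPart, fderiv_compLp_toL2_apply hs _ hΨ]
  refine integral_congr_ae ?_
  filter_upwards [reCLM.coeFn_compLp (toL2 (fderiv ℝ Ψ v h)),
    reCLM.coeFn_compLp (toL2 (fderiv ℝ Ψ v k)), imCLM.coeFn_compLp (toL2 (fderiv ℝ Ψ v h)),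
    imCLM.coeFn_compLp (toL2 (fderiv ℝ Ψ v k))] with x h₁ h₂ h₃ h₄
  rw [h₁, h₂, h₃, h₄]
  simp
  ring

/-- One step of the scheme preserves the symplectic form. -/
theorem symplecticForm_eq_of_isMidpointStep {s : ℝ} (hs : 1 / 2 < s) {σ : ℕ} {δt δW : ℝ}
    (hδ : δt ≠ 0) {D : Set (Sobolev s)} (hD : IsOpen D) {Ψ Ψ' : Sobolev s → Sobolev s}
    (hstep : ∀ w ∈ D, IsMidpointStep σ δt δW (Ψ w) (Ψ' w)) {v : Sobolev s} (hv : v ∈ D)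
    (hΨ : DifferentiableAt ℝ Ψ v) (hΨ' : DifferentiableAt ℝ Ψ' v) :
    symplecticForm Ψ' v = symplecticForm Ψ v := by
  have hs₀ : 0 ≤ s := by linarith
  ext h k
  rw [symplecticForm_eq_im_inner hs₀ hΨ, symplecticForm_eq_im_inner hs₀ hΨ']
  set A := fderiv ℝ Ψ v
  set A' := fderiv ℝ Ψ' v
  set m := midValue (Ψ v) (Ψ' v)
  have hb (h : Sobolev s) := memLp_fderiv_nonlin_toL2 hs σ m (midValue (A h) (A' h))
  have hw (h : Sobolev s) (φ : 𝓢(ℝ, ℂ)) :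
      I * (((toL2 (A' h) - toL2 (A h) : Lp ℂ 2 (volume : Measure ℝ)) : 𝓢'(ℝ, ℂ)) φ / δt)
        + (δW / δt : ℝ) * (Δ (toL2 (midValue (A h) (A' h)) : 𝓢'(ℝ, ℂ))) φ
        + ((hb h).toLp _ : 𝓢'(ℝ, ℂ)) φ = 0 := by
    have hline : HasDerivAt (fun t : ℝ ↦ v + t • h) h 0 := by
      simpa using ((hasDerivAt_id (0 : ℝ)).smul_const h).const_add v
    have e : v + (0 : ℝ) • h = v := by simp
    have hγ : HasDerivAt (fun t : ℝ ↦ Ψ (v + t • h)) (A h) 0 :=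
      HasFDerivAt.comp_hasDerivAt (0 : ℝ) (by rw [e]; exact hΨ.hasFDerivAt) hline
    have hγ' : HasDerivAt (fun t : ℝ ↦ Ψ' (v + t • h)) (A' h) 0 :=
      HasFDerivAt.comp_hasDerivAt (0 : ℝ) (by rw [e]; exact hΨ'.hasFDerivAt) hline
    have hev := hline.continuousAt.eventually_mem (s := D) (by rw [e]; exact hD.mem_nhds hv)
    have := linearized_step hs hγ hγ' (hev.mono fun t ht ↦ hstep _ ht) φ
    rw [e] at this
    rwa [toTemperedDistribution_toLp_apply, ← map_sub]
  have key := inner_sub_inner_eq hδ (toL2_midValue (A h) (A' h)) (toL2_midValue (A k) (A' k))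
    (hw h) (hw k)
  -- The derivative of the nonlinearity is only real linear, so symmetry is available for real parts
  -- alone; they suffice, since the real part of $\mathrm i z$ is $-\operatorname{Im}z$.
  have hsymm : (inner ℂ ((hb h).toLp _) (toL2 (midValue (A k) (A' k)))).re =
      (inner ℂ (toL2 (midValue (A h) (A' h))) ((hb k).toLp _)).re := by
    rw [L2.inner_def, L2.inner_def]
    refine (integral_re (𝕜 := ℂ) (L2.integrable_inner _ _)).symm.trans
      (Eq.trans (integral_congr_ae ?_) (integral_re (𝕜 := ℂ) (L2.integrable_inner _ _)))
    filter_upwards [(hb h).coeFn_toLp, (hb k).coeFn_toLp] with x h₁ h₂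
    rw [h₁, h₂]
    exact (inner_fderiv_nonlin_symm σ _ _ _).symm
  have := congrArg re key
  simp only [mul_re, I_re, I_im, sub_re, sub_im, ofReal_re, ofReal_im, hsymm] at this
  linarith

end Symplectic

theorem timeStep_ne_zero {T : ℝ≥0} (hT : 0 < T) {N : ℕ} (hN : 0 < N) :
    ((timeStep T N : ℝ≥0) : ℝ) ≠ 0 := by
  have : 0 < timeStep T N := div_pos hT (by exact_mod_cast hN)
  exact_mod_cast this.ne'

end MidpointNLS


theorem mainTheorem7
    {Ω : Type*} [MeasurableSpace Ω] (P : Measure Ω) [IsProbabilityMeasure P]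
    (W : ℝ≥0 → Ω → ℝ) (hW : IsBrownianReal W P)
    (s : ℝ) (hs : 1 / 2 < s) (σ : ℕ) (hσ : σ ≤ 2)
    (T : ℝ≥0) (hT : 0 < T) (N : ℕ) (hN : 0 < N) :
    -- the symplectic structure is preserved
    (∀ (D : Ω → Set (MidpointNLS.Sobolev s))
        (u : ℕ → Ω → MidpointNLS.Sobolev s → MidpointNLS.Sobolev s),
      (∀ᵐ ω ∂P, MidpointNLS.IsSchemeFlow σ W T N ω (D ω) (fun n ↦ u n ω)) →
      ∀ᵐ ω ∂P, ∀ n < N, ∀ v ∈ D ω,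
        DifferentiableAt ℝ (u n ω) v → DifferentiableAt ℝ (u (n + 1) ω) v →
        MidpointNLS.symplecticForm (u (n + 1) ω) v = MidpointNLS.symplecticForm (u n ω) v) ∧
    -- the charge is preserved
    (∀ u : ℕ → Ω → MidpointNLS.Sobolev s,
      (∀ᵐ ω ∂P, MidpointNLS.SolvesScheme σ W T N ω (fun n ↦ u n ω)) →
      ∀ᵐ ω ∂P, ∀ n < N,
        MidpointNLS.charge (u (n + 1) ω) = MidpointNLS.charge (u n ω)) := by
  have hδ := MidpointNLS.timeStep_ne_zero hT hN
  refine ⟨fun D u hu ↦ ?_, fun u hu ↦ ?_⟩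
  · filter_upwards [hu] with ω hω n hn v hv h h'
    exact MidpointNLS.symplecticForm_eq_of_isMidpointStep hs hδ hω.isOpen
      (fun w hw ↦ hω.solves w hw n hn) hv h h'
  · filter_upwards [hu] with ω hω n hn
    exact (hω n hn).charge_eq hs hδ
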